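/- Let $N_1,N_2,K,M,J\in\mathbb N_0$ and $I\in\mathbb N$, $I\ge 1$. Let $\mathcal X\subseteq\mathbb R^{N_1}$, $Q\in\mathbb R^{N_2\times K}$, $q\in\mathbb R^{N_2}$, $W\in\mathbb R^{M\times N_2}$, $S\in\mathbb R^{J\times K}$, $t\in\mathbb R^J$, let $T(x)\in\mathbb R^{M\times K}$ and $h(x)\in\mathbb R^M$ be affine functions of $x\in\mathbb R^{N_1}$, and let $\Xi=\{\xi\in\mathbb R^K_+: S\xi\le t\}$. Let $\hat\xi_1,\dots,\hat\xi_I\in\Xi$ (so $\Xi\neq\emptyset$), let $\hat{\mathbb P}_I=\frac1I\sum_{i=1}^I\delta_{\hat\xi_i}$, and let $\epsilon\ge 0$. The recourse function is $$Z(x,\xi)=\inf\{(Q\xi+q)^\top y:\ y\in\mathbb R^{N_2},\ T(x)\xi+h(x)\le Wy\}\in[-\infty,+\infty].$$ Assume sufficiently expensive recourse: for every $\xi\in\Xi$ there is $p\in\mathbb R^M_+$ with $Q\xi+q=W^\top p$. Let $\mathcal M^2(\Xi)$ be the set of probability distributions supported on $\Xi$ with finite second moment, and let $$W^2(\mathbb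 P_1,\mathbb P_2)=\inf_{\Pi}\Big(\int\|\xi_1-\xi_2\|_2^2\,\Pi(\mathrm d\xi_1,\mathrm d\xi_2)\Big)^{1/2}$$ be the 2-Wasserstein distance, where $\Pi$ ranges over the joint distributions with marginals $\mathbb P_1$ and $\mathbb P_2$. The worst-case expectation is $$\mathcal Z(x)=\sup\big\{\mathbb E_{\mathbb P}[Z(x,\tilde\xi)]:\ \mathbb P\in\mathcal M^2(\Xi),\ W^2(\mathbb P,\hat{\mathbb P}_I)\le\epsilon\big\},$$ where $\mathbb E_{\mathbb P}[f]=\int f^+\,\mathrm d\mathbb P-\int f^-\,\mathrm d\mathbb P$, read as $+\infty$ if $\int f^+\,\mathrm d\mathbb P=\infty$. Define the extended recourse parameters $$\mathcal Q=\begin{bmatrix}Q\\S\end{bmatrix},\quad \mathscr q=\begin{bmatrix}q\\-t\end{bmatrix},\quad \mathcal T(x)=\begin{bmatrix}T(x)\\0\end{bmatrix},\quad \mathscr h(x)=\begin{bmatrix}h(x)\\0\end{bmatrix},\quad \mathcal W=\begin{bmatrix}W&0\\0&-\mathbb I\end{bmatrix}.$$ A real matrix $A$ is copositive, $A\succeq_{\mathcal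 C}0$, if it is symmetric and $v^\top Av\ge 0$ for all $v\ge 0$. Let $\overline{\mathcal Z}(x)$ be the optimal value ($+\infty$ if infeasible) of the copositive program $$\inf\ \epsilon^2\lambda+\frac1I\sum_{i=1}^I\Big[s_i+\mathscr q^\top\psi_i-\lambda\|\hat\xi_i\|_2^2+\sum_{j=1}^{N_2+J}\phi_{ij}\mathscr q_j^2\Big]$$ over $\lambda\in\mathbb R_+$, $s_i\in\mathbb R$ and $\psi_i,\phi_i\in\mathbb R^{N_2+J}$ ($i=1,\dots,I$), subject to, for every $i=1,\dots,I$, $$\begin{bmatrix}\lambda\mathbb I+\mathcal Q^\top\mathrm{diag}(\phi_i)\mathcal Q & -\tfrac12\mathcal T(x)^\top-\mathcal Q^\top\mathrm{diag}(\phi_i)\mathcal W^\top & -\lambda\hat\xi_i-\tfrac12\mathcal Q^\top\psi_i\\ -\tfrac12\mathcal T(x)-\mathcal W\,\mathrm{diag}(\phi_i)\mathcal Q & \mathcal W\,\mathrm{diag}(\phi_i)\mathcal W^\top & \tfrac12(\mathcal W\psi_i-\mathscr h(x))\\ (-\lambda\hat\xi_i-\tfrac12\mathcal Q^\top\psi_i)^\top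 & \tfrac12(\mathcal W\psi_i-\mathscr h(x))^\top & s_i\end{bmatrix}\succeq_{\mathcal C}0.$$ Then, for every fixed $x\in\mathcal X$, $\ \mathcal Z(x)\le\overline{\mathcal Z}(x)$. -/

import Mathlib

open Matrix MeasureTheory
open scoped ENNReal

namespace TwoStage

/-- Data of a two-stage distributionally robust linear program with right-hand side and objective
uncertainty `ξ ∈ ℝ^K`, here-and-now decision `x ∈ ℝ^N₁`, wait-and-see decision `y ∈ ℝ^N₂`,
`M` recourse constraints, `J` support constraints and `I` samples. Only raw data, no assumptions. -/
structure Problem (N₁ N₂ K M J I : ℕ) where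
  /-- feasible set of the here-and-now decisions -/
  X : Set (Fin N₁ → ℝ)
  /-- recourse cost matrix -/
  Q : Matrix (Fin N₂) (Fin K) ℝ
  /-- recourse cost offset -/
  q : Fin N₂ → ℝ
  /-- affine dependence of the technology matrix on `x` -/
  T : (Fin N₁ → ℝ) →ᵃ[ℝ] Matrix (Fin M) (Fin K) ℝ
  /-- affine dependence of the right-hand side on `x` -/
  h : (Fin N₁ → ℝ) →ᵃ[ℝ] (Fin M → ℝ)
  /-- recourse matrix -/
  W : Matrix (Fin M) (Fin N₂) ℝ
  /-- support constraint matrix -/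
  S : Matrix (Fin J) (Fin K) ℝ
  /-- support constraint right-hand side -/
  t : Fin J → ℝ
  /-- samples -/
  sample : Fin I → EuclideanSpace ℝ (Fin K)
  /-- Wasserstein radius -/
  ε : ℝ

section Measures

variable {E : Type*} [MeasurableSpace E]

/-- Expectation of an extended-real-valued function, `∫ f⁺ - ∫ f⁻`, equal to `+∞` whenever
`∫ f⁺ = ∞`. -/
noncomputable def expectation (P : Measure E) (f : E → EReal) : EReal :=
  open Classical in
  if ∫⁻ ξ, (f ξ).toENNReal ∂P = ⊤ then ⊤
  else ((∫⁻ ξ, (f ξ).toENNReal ∂P : ℝ≥0∞) : EReal) - ((∫⁻ ξ, (-f ξ).toENNReal ∂P : ℝ≥0∞) : EReal)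

variable [PseudoEMetricSpace E]

/-- Probability distributions supported on `Ξ` with finite `r`-th moment. -/
def momentMeasures (Ξ : Set E) (r : ℝ) : Set (Measure E) :=
  {P | IsProbabilityMeasure P ∧ (∀ᵐ ξ ∂P, ξ ∈ Ξ) ∧ ∃ ξ₀ ∈ Ξ, ∫⁻ ξ, edist ξ ξ₀ ^ r ∂P < ⊤}

/-- The `r`-Wasserstein distance. -/
noncomputable def wasserstein (r : ℝ) (P₁ P₂ : Measure E) : ℝ≥0∞ :=
  ⨅ (π : Measure (E × E)) (_ : π.map Prod.fst = P₁ ∧ π.map Prod.snd = P₂),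
    (∫⁻ z, edist z.1 z.2 ^ r ∂π) ^ (1 / r)

/-- The `r`-Wasserstein ball of radius `ε` around `P₀` within the distributions on `Ξ`. -/
def wassersteinBall (Ξ : Set E) (r ε : ℝ) (P₀ : Measure E) : Set (Measure E) :=
  {P | P ∈ momentMeasures Ξ r ∧ wasserstein r P P₀ ≤ ENNReal.ofReal ε}

end Measures

/-- Copositive matrices: symmetric with non-negative quadratic form on the non-negative orthant. -/
def Copositive {n : Type*} [Fintype n] (A : Matrix n n ℝ) : Prop :=
  A.IsSymm ∧ ∀ v : n → ℝ, 0 ≤ v → 0 ≤ v ⬝ᵥ (A *ᵥ v)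

namespace Problem

variable {N₁ N₂ K M J I : ℕ} (p : Problem N₁ N₂ K M J I)

/-- The support set `Ξ = {ξ ≥ 0 : S ξ ≤ t}`. -/
def support : Set (EuclideanSpace ℝ (Fin K)) :=
  {ξ | 0 ≤ ξ.ofLp ∧ p.S *ᵥ ξ.ofLp ≤ p.t}

/-- The recourse function `Z(x, ξ) = inf {(Q ξ + q)ᵀ y : T(x) ξ + h(x) ≤ W y}`. -/
noncomputable def recourse (x : Fin N₁ → ℝ) (ξ : EuclideanSpace ℝ (Fin K)) : EReal :=
  ⨅ (y : Fin N₂ → ℝ) (_ : p.T x *ᵥ ξ.ofLp + p.h x ≤ p.W *ᵥ y),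
    (((p.Q *ᵥ ξ.ofLp + p.q) ⬝ᵥ y : ℝ) : EReal)

/-- Sufficiently expensive recourse: the dual recourse problem is feasible for every `ξ ∈ Ξ`. -/
def SufficientlyExpensiveRecourse : Prop :=
  ∀ ξ ∈ p.support, ∃ ρ : Fin M → ℝ, 0 ≤ ρ ∧ p.Q *ᵥ ξ.ofLp + p.q = p.Wᵀ *ᵥ ρ

/-- The empirical distribution of the samples. -/
noncomputable def empirical : Measure (EuclideanSpace ℝ (Fin K)) :=
  (I : ℝ≥0∞)⁻¹ • ∑ i, Measure.dirac (p.sample i)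

/-- The worst-case expectation over the 2-Wasserstein ball, with the Euclidean metric. -/
noncomputable def worstCase (x : Fin N₁ → ℝ) : EReal :=
  ⨆ P ∈ wassersteinBall p.support 2 p.ε p.empirical, expectation P (p.recourse x)

/-! Extended recourse parameters. -/

/-- `𝒬 = [Q; S]` -/
def extQ : Matrix (Fin N₂ ⊕ Fin J) (Fin K) ℝ := fromRows p.Q p.S

/-- `𝓆 = [q; -t]` -/
def extq : Fin N₂ ⊕ Fin J → ℝ := Sum.elim p.q (-p.t)

/-- `𝒯(x) = [T(x); 0]` -/
def extT (x : Fin N₁ → ℝ) : Matrix (Fin M ⊕ Fin J) (Fin K) ℝ := fromRows (p.T x) 0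

/-- `𝒽(x) = [h(x); 0]` -/
def exth (x : Fin N₁ → ℝ) : Fin M ⊕ Fin J → ℝ := Sum.elim (p.h x) 0

/-- `𝒲 = [W 0; 0 -𝕀]` -/
def extW : Matrix (Fin M ⊕ Fin J) (Fin N₂ ⊕ Fin J) ℝ := fromBlocks p.W 0 0 (-1)

/-- The decision variables `(lam, s, ψ, φ)` of the copositive program. -/
structure CPVars (N₂ J I : ℕ) where
  lam : ℝ
  s : Fin I → ℝ
  ψ : Fin I → (Fin N₂ ⊕ Fin J → ℝ)
  φ : Fin I → (Fin N₂ ⊕ Fin J → ℝ)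

/-- The matrix of the `i`-th copositivity constraint. -/
noncomputable def cpMatrix (x : Fin N₁ → ℝ) (v : CPVars N₂ J I) (i : Fin I) :
    Matrix ((Fin K ⊕ (Fin M ⊕ Fin J)) ⊕ Unit) ((Fin K ⊕ (Fin M ⊕ Fin J)) ⊕ Unit) ℝ :=
  let D := diagonal (v.φ i)
  let u : Fin K → ℝ :=
    -(v.lam • (p.sample i).ofLp) - (1 / 2 : ℝ) • (p.extQᵀ *ᵥ v.ψ i)
  let w : Fin M ⊕ Fin J → ℝ := (1 / 2 : ℝ) • (p.extW *ᵥ v.ψ i - p.exth x)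
  fromBlocks
    (fromBlocks
      (v.lam • (1 : Matrix (Fin K) (Fin K) ℝ) + p.extQᵀ * D * p.extQ)
      (-((1 / 2 : ℝ) • (p.extT x)ᵀ) - p.extQᵀ * D * p.extWᵀ)
      (-((1 / 2 : ℝ) • p.extT x) - p.extW * D * p.extQ)
      (p.extW * D * p.extWᵀ))
    (replicateCol Unit (Sum.elim u w))
    (replicateRow Unit (Sum.elim u w))
    (of fun _ _ => v.s i)

/-- Feasibility in the copositive program. -/
def CPFeasible (x : Fin N₁ → ℝ) (v : CPVars N₂ J I) : Prop :=
  0 ≤ v.lam ∧ ∀ i, Copositive (p.cpMatrix x v i)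

/-- The objective function of the copositive program. -/
noncomputable def cpObjective (v : CPVars N₂ J I) : ℝ :=
  p.ε ^ 2 * v.lam + (1 / (I : ℝ)) * ∑ i,
    (v.s i + p.extq ⬝ᵥ v.ψ i - v.lam * ‖p.sample i‖ ^ 2 + ∑ j, v.φ i j * p.extq j ^ 2)

/-- The optimal value of the copositive program (`+∞` if it is infeasible). -/
noncomputable def copositiveValue (x : Fin N₁ → ℝ) : EReal :=
  ⨅ (v : CPVars N₂ J I) (_ : p.CPFeasible x v), (p.cpObjective v : EReal)

end Problem

end TwoStage

namespace TwoStage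

/-- Farkas' lemma for finitely many linear functionals on an arbitrary real vector space. -/
theorem farkas {V ι : Type*} [AddCommGroup V] [Module ℝ V] (s : Finset ι) :
    ∀ (a : ι → V →ₗ[ℝ] ℝ) (b : V →ₗ[ℝ] ℝ), (∀ v, (∀ i ∈ s, a i v ≤ 0) → b v ≤ 0) →
      ∃ u : ι → ℝ, 0 ≤ u ∧ ∀ v, b v = ∑ i ∈ s, u i * a i v := by
  classical
  induction s using Finset.induction_on with
  | empty =>
    intro a b hb
    refine ⟨0, le_rfl, fun v => ?_⟩
    have h1 := hb v (by simp)
    have h2 := hb (-v) (by simp)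
    rw [map_neg] at h2
    rw [Finset.sum_empty]
    linarith
  | insert m s hm ih =>
    intro a b hb
    by_cases h : ∀ v, (∀ i ∈ s, a i v ≤ 0) → b v ≤ 0
    · obtain ⟨u, hu, hub⟩ := ih a b h
      refine ⟨fun i => if i = m then 0 else u i, fun i => ?_, fun v => ?_⟩
      · dsimp only
        split_ifs
        exacts [le_rfl, hu i]
      · rw [Finset.sum_insert hm, hub v]
        dsimp only
        rw [if_pos rfl, zero_mul, zero_add]
        exact Finset.sum_congr rfl fun i hi => by rw [if_neg (ne_of_mem_of_not_mem hi hm)]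
    · push Not at h
      obtain ⟨w, hw, hbw⟩ := h
      have hmw : 0 < a m w := by
        by_contra hcon
        exact absurd (hb w fun i hi => (Finset.mem_insert.1 hi).elim
          (fun e => e ▸ not_lt.1 hcon) (hw i)) (not_le.2 hbw)
      obtain ⟨z, hz, hbz, hmz⟩ : ∃ z, (∀ i ∈ s, a i z ≤ 0) ∧ 0 < b z ∧ a m z = 1 := by
        refine ⟨(a m w)⁻¹ • w, fun i hi => ?_, ?_, ?_⟩
        · rw [map_smul, smul_eq_mul]
          exact mul_nonpos_of_nonneg_of_nonpos (inv_pos.2 hmw).le (hw i hi)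
        · rw [map_smul, smul_eq_mul]
          exact mul_pos (inv_pos.2 hmw) hbw
        · rw [map_smul, smul_eq_mul, inv_mul_cancel₀ hmw.ne']
      obtain ⟨u, hu, hub⟩ := ih (fun i => a i - a i z • a m) (b - b z • a m) (by
        intro v hv
        have key := hb (v - a m v • z) (by
          intro i hi
          rw [map_sub, map_smul, smul_eq_mul]
          rcases Finset.mem_insert.1 hi with rfl | hi
          · rw [hmz]; simp
          · have := hv i hi
            simp only [LinearMap.sub_apply, LinearMap.smul_apply, smul_eq_mul] at this
            linarith)
        simp only [map_sub, map_smul, smul_eq_mul, LinearMap.sub_apply,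
          LinearMap.smul_apply] at key ⊢
        linarith)
      refine ⟨fun i => if i = m then b z - ∑ j ∈ s, u j * a j z else u i, fun i => ?_,
        fun v => ?_⟩
      · dsimp only
        split_ifs
        · have : ∑ j ∈ s, u j * a j z ≤ 0 :=
            Finset.sum_nonpos fun j hj => mul_nonpos_of_nonneg_of_nonpos (hu j) (hz j hj)
          simp only [Pi.zero_apply]
          linarith
        · exact hu i
      · have h1 := hub v
        simp only [LinearMap.sub_apply, LinearMap.smul_apply, smul_eq_mul, mul_sub,
          Finset.sum_sub_distrib] at h1
        rw [Finset.sum_insert hm]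
        dsimp only
        rw [if_pos rfl, sub_mul, Finset.sum_mul]
        have h2 : ∑ i ∈ s, (if i = m then b z - ∑ j ∈ s, u j * a j z else u i) * a i v
            = ∑ i ∈ s, u i * a i v :=
          Finset.sum_congr rfl fun i hi => by rw [if_neg (ne_of_mem_of_not_mem hi hm)]
        rw [h2]
        simp only [mul_assoc]
        linarith

/-- Strong duality of linear programming: if the dual program is feasible with all its values
bounded by `r`, then the primal program has a feasible point of value at most `r`. -/
theorem exists_primal_le_of_dual_le {m n : Type*} [Fintype m] [Fintype n] (W : Matrix m n ℝ)
    (b : m → ℝ) (c : n → ℝ) (r : ℝ) (hne : ∃ ρ : m → ℝ, 0 ≤ ρ ∧ c = Wᵀ *ᵥ ρ)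
    (hr : ∀ ρ : m → ℝ, 0 ≤ ρ → c = Wᵀ *ᵥ ρ → b ⬝ᵥ ρ ≤ r) :
    ∃ y : n → ℝ, b ≤ W *ᵥ y ∧ c ⬝ᵥ y ≤ r := by
  classical
  by_contra hcon
  push Not at hcon
  let rowL : m → ((n → ℝ) × ℝ) →ₗ[ℝ] ℝ := fun i =>
    b i • LinearMap.snd ℝ _ _ - (LinearMap.proj i ∘ₗ W.mulVecLin) ∘ₗ LinearMap.fst ℝ _ _
  let objL : ((n → ℝ) × ℝ) →ₗ[ℝ] ℝ :=
    dotProductBilin ℝ ℝ c ∘ₗ LinearMap.fst ℝ _ _ - r • LinearMap.snd ℝ _ _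
  obtain ⟨u, hu, hub⟩ := farkas (Finset.univ : Finset (Option m))
    (fun i => i.elim objL rowL) (LinearMap.snd ℝ (n → ℝ) ℝ) (by
      rintro ⟨y, τ⟩ hv
      by_contra hτ
      simp only [LinearMap.snd_apply, not_le] at hτ
      have hrow : ∀ i, b i * τ ≤ (W *ᵥ y) i := fun i => by
        have := hv (some i) (Finset.mem_univ _)
        simpa [rowL] using this
      have hobj : c ⬝ᵥ y ≤ r * τ := by
        have := hv none (Finset.mem_univ _)
        simpa [objL] using this
      have h1 := hcon (τ⁻¹ • y) (fun i => by
        rw [mulVec_smul, Pi.smul_apply, smul_eq_mul, inv_mul_eq_div, le_div_iff₀ hτ]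
        exact hrow i)
      rw [dotProduct_smul, smul_eq_mul, inv_mul_eq_div, lt_div_iff₀ hτ] at h1
      linarith)
  simp only [Fintype.sum_option, Option.elim_none, Option.elim_some] at hub
  set μ : m → ℝ := fun i => u (some i) with hμ
  set τ := u none with hτ
  have hμ0 : 0 ≤ μ := fun i => hu _
  have hτ0 : 0 ≤ τ := hu _
  have hb : b ⬝ᵥ μ = 1 + τ * r := by
    have := hub (0, 1)
    simp [rowL, objL] at this
    have h2 : b ⬝ᵥ μ = ∑ i, μ i * b i := by
      simp only [dotProduct, mul_comm]
    rw [h2]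
    simp only [hμ]
    linarith
  have hW : Wᵀ *ᵥ μ = τ • c := by
    ext j
    have := hub (Pi.single j 1, 0)
    simp [rowL, objL] at this
    simp only [mulVec, dotProduct, transpose_apply, Pi.smul_apply, smul_eq_mul, hμ]
    have h2 : ∑ i, W i j * u (some i) = ∑ i, u (some i) * W i j := by
      simp only [mul_comm]
    rw [h2]
    linarith
  obtain ⟨ρ, hρ, hρc⟩ := hne
  set k : ℝ := |r - b ⬝ᵥ ρ| + 1 with hk
  have hk0 : 0 ≤ k := by positivity
  have hpos : 0 < 1 + k * τ := by positivity
  have h1 := hr ((1 + k * τ)⁻¹ • (ρ + k • μ))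
    (smul_nonneg (inv_pos.2 hpos).le (add_nonneg hρ (smul_nonneg hk0 hμ0))) (by
      rw [mulVec_smul, mulVec_add, mulVec_smul, hW, ← hρc, smul_smul]
      have : c + (k * τ) • c = (1 + k * τ) • c := by rw [add_smul, one_smul]
      rw [this, smul_smul, inv_mul_cancel₀ hpos.ne', one_smul])
  rw [dotProduct_smul, smul_eq_mul, inv_mul_eq_div, div_le_iff₀ hpos, dotProduct_add,
    dotProduct_smul, hb, smul_eq_mul] at h1
  have h2 := le_abs_self (r - b ⬝ᵥ ρ)
  linarith

theorem lintegral_toENNReal_add_le {F : Type*} [MeasurableSpace F] {π : Measure F} {f : F → EReal}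
    {g : F → ℝ} (hg : Measurable g) (hfg : ∀ᵐ z ∂π, f z ≤ g z) :
    ∫⁻ z, (f z).toENNReal ∂π + ∫⁻ z, ENNReal.ofReal (-g z) ∂π ≤
      ∫⁻ z, ENNReal.ofReal (g z) ∂π + ∫⁻ z, (-f z).toENNReal ∂π := by
  have hn : Measurable fun z => ENNReal.ofReal (-g z) := hg.neg.ennreal_ofReal
  rw [← lintegral_add_right _ hn, ← lintegral_add_left hg.ennreal_ofReal]
  refine lintegral_mono_ae (hfg.mono fun z hz => ?_)
  induction h : f z using EReal.rec with
  | bot => simp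
  | top => rw [h] at hz; exact absurd hz (by simp)
  | coe a =>
    rw [h, EReal.coe_le_coe_iff] at hz
    rw [← EReal.coe_neg, EReal.real_coe_toENNReal, EReal.real_coe_toENNReal]
    rcases le_total 0 a with ha | ha
    · rw [ENNReal.ofReal_of_nonpos (p := -g z) (by linarith), add_zero]
      exact (ENNReal.ofReal_le_ofReal hz).trans le_self_add
    · rw [ENNReal.ofReal_of_nonpos ha, zero_add]
      exact (ENNReal.ofReal_le_ofReal (by linarith)).trans le_add_self

/-- The expectation of a function with an integrable majorant on a coupling space. -/
theorem expectation_map_le_integral {E F : Type*} [MeasurableSpace E] [MeasurableSpace F]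
    {π : Measure F} {φ : F → E} (hφ : Measurable φ) {f : E → EReal} (hf : Measurable f)
    {g : F → ℝ} (hg : Measurable g) (hgi : Integrable g π) (hfg : ∀ᵐ z ∂π, f (φ z) ≤ g z) :
    expectation (π.map φ) f ≤ ((∫ z, g z ∂π : ℝ) : EReal) := by
  have key := lintegral_toENNReal_add_le hg hfg
  have hGp : ∫⁻ z, ENNReal.ofReal (g z) ∂π ≠ ⊤ := hgi.lintegral_lt_top.ne
  have hGn : ∫⁻ z, ENNReal.ofReal (-g z) ∂π ≠ ⊤ := hgi.neg.lintegral_lt_top.ne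
  have hA : ∫⁻ z, (f (φ z)).toENNReal ∂π ≠ ⊤ := by
    refine ne_top_of_le_ne_top hGp (lintegral_mono_ae (hfg.mono fun z hz => ?_))
    simpa using EReal.toENNReal_le_toENNReal hz
  have hn : Measurable fun ξ => (-f ξ).toENNReal := hf.neg.ereal_toENNReal
  unfold expectation
  rw [lintegral_map hf.ereal_toENNReal hφ, lintegral_map hn hφ, if_neg hA,
    integral_eq_lintegral_pos_part_sub_lintegral_neg_part hgi]
  generalize ∫⁻ z, (f (φ z)).toENNReal ∂π = A at *
  generalize ∫⁻ z, (-f (φ z)).toENNReal ∂π = B at *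
  generalize ∫⁻ z, ENNReal.ofReal (g z) ∂π = G at *
  generalize ∫⁻ z, ENNReal.ofReal (-g z) ∂π = H at *
  lift A to NNReal using hA
  lift G to NNReal using hGp
  lift H to NNReal using hGn
  induction B using ENNReal.recTopCoe with
  | top => simp
  | coe B =>
    norm_cast at key
    have : (A : ℝ) + H ≤ G + B := by exact_mod_cast key
    simp only [ENNReal.coe_toReal]
    change ((A : ℝ) : EReal) - ((B : ℝ) : EReal) ≤ _
    rw [← EReal.coe_sub, EReal.coe_le_coe_iff]
    linarith

/-- Values attached to the points of a finite family can be realised by a measurable function of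
the point, taking at each point one of its values, at most each of them. -/
theorem exists_measurable_le_of_finite {ι E : Type*} [Finite ι] [MeasurableSpace E]
    [MeasurableSingletonClass E] (a : ι → E) (c : ι → ℝ) :
    ∃ f : E → ℝ, Measurable f ∧ ∀ i, f (a i) ≤ c i ∧ ∃ j, a j = a i ∧ f (a i) = c j := by
  classical
  let f : E → ℝ := fun e => if e ∈ Set.range a then sInf (c '' {j | a j = e}) else 0
  refine ⟨f, ?_, fun i => ?_⟩
  · refine (measurable_const (a := (0 : ℝ))).measurable_of_countable_ne
      ((Set.finite_range a).countable.mono fun e he => ?_)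
    by_contra h
    exact he (by simp only [f, if_neg h])
  · have hf : f (a i) = sInf (c '' {j | a j = a i}) := if_pos ⟨i, rfl⟩
    have hfin : (c '' {j | a j = a i}).Finite := Set.toFinite _
    refine ⟨hf ▸ csInf_le hfin.bddBelow ⟨i, rfl, rfl⟩, ?_⟩
    obtain ⟨j, hj, hjc⟩ := Set.Nonempty.csInf_mem (Set.Nonempty.image c (s := {j | a j = a i}) ⟨i, rfl⟩) hfin
    exact ⟨j, hj, hf.trans hjc.symm⟩

theorem expectation_le_of_coupling {E : Type*} [NormedAddCommGroup E] [MeasurableSpace E]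
    [BorelSpace E] [SecondCountableTopology E] {ι : Type*} [Fintype ι] [Nonempty ι] {Ξ : Set E}
    {P : Measure E} (hP : ∀ᵐ ξ ∂P, ξ ∈ Ξ) (a : ι → E) (c : ι → ℝ) {f : E → EReal}
    (hf : Measurable f) {lam δ : ℝ} (hlam : 0 ≤ lam) (hδ : 0 ≤ δ)
    (hfle : ∀ ξ ∈ Ξ, ∀ i, f ξ ≤ ((lam * ‖ξ - a i‖ ^ 2 + c i : ℝ) : EReal))
    {π : Measure (E × E)} (h1 : π.map Prod.fst = P)
    (h2 : π.map Prod.snd = (Fintype.card ι : ℝ≥0∞)⁻¹ • ∑ i, Measure.dirac (a i))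
    (hπ : (∫⁻ z, edist z.1 z.2 ^ (2 : ℝ) ∂π) ^ (1 / (2 : ℝ)) ≤ ENNReal.ofReal δ) :
    expectation P f ≤ ((lam * δ ^ 2 + (1 / (Fintype.card ι : ℝ)) * ∑ i, c i : ℝ) : EReal) := by
  obtain ⟨k, hk, hkc⟩ := exists_measurable_le_of_finite a c
  have hd : ∀ z : E × E, edist z.1 z.2 ^ (2 : ℝ) = ENNReal.ofReal (‖z.1 - z.2‖ ^ 2) := fun z => by
    rw [edist_dist, dist_eq_norm, ENNReal.ofReal_rpow_of_nonneg (norm_nonneg _) (by norm_num)]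
    norm_num
  have hπ2 : ∫⁻ z, ENNReal.ofReal (‖z.1 - z.2‖ ^ 2) ∂π ≤ ENNReal.ofReal (δ ^ 2) := by
    simp only [hd] at hπ
    have := ENNReal.rpow_le_rpow hπ (z := 2) (by norm_num)
    rw [← ENNReal.rpow_mul, ENNReal.ofReal_rpow_of_nonneg hδ (by norm_num), Real.rpow_two, one_div,
      inv_mul_cancel₀ two_ne_zero, ENNReal.rpow_one] at this
    exact this
  have hdm : Measurable fun z : E × E => ‖z.1 - z.2‖ ^ 2 := by fun_prop
  have hdi : Integrable (fun z : E × E => ‖z.1 - z.2‖ ^ 2) π := by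
    refine ⟨hdm.aestronglyMeasurable, ?_⟩
    rw [hasFiniteIntegral_iff_ofReal (Filter.Eventually.of_forall fun z => by positivity)]
    exact hπ2.trans_lt ENNReal.ofReal_lt_top
  have hdint : ∫ z, ‖z.1 - z.2‖ ^ 2 ∂π ≤ δ ^ 2 := by
    rw [integral_eq_lintegral_of_nonneg_ae (Filter.Eventually.of_forall fun z => by positivity)
      hdm.aestronglyMeasurable]
    exact ENNReal.toReal_le_of_le_ofReal (by positivity) hπ2
  have hki : Integrable k (π.map Prod.snd) := by
    rw [h2]
    refine Integrable.smul_measure ?_ (by simp)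
    rw [integrable_finsetSum_measure]
    exact fun i _ => (integrable_dirac (by simp))
  have hkint : ∫ z, k z.2 ∂π ≤ (1 / (Fintype.card ι : ℝ)) * ∑ i, c i := by
    rw [← integral_map measurable_snd.aemeasurable hk.aestronglyMeasurable, h2,
      integral_smul_measure, integral_finsetSum_measure fun i _ => integrable_dirac (by simp)]
    simp only [integral_dirac, ENNReal.toReal_inv, ENNReal.toReal_natCast, smul_eq_mul, one_div]
    gcongr with i
    exact (hkc i).1
  have hki' : Integrable (fun z : E × E => k z.2) π := hki.comp_measurable measurable_snd
  have ae1 : ∀ᵐ z ∂π, z.1 ∈ Ξ := ae_of_ae_map measurable_fst.aemeasurable (by rwa [h1])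
  have ae2 : ∀ᵐ z ∂π, z.2 ∈ Set.range a := by
    refine ae_of_ae_map measurable_snd.aemeasurable ?_
    rw [h2]
    refine Measure.ae_smul_measure ?_ _
    rw [← Measure.sum_fintype, Measure.ae_sum_iff]
    intro i
    exact (ae_dirac_iff (Set.finite_range a).measurableSet).2 ⟨i, rfl⟩
  rw [← h1]
  refine (expectation_map_le_integral measurable_fst hf
    (g := fun z => lam * ‖z.1 - z.2‖ ^ 2 + k z.2) (by fun_prop)
    ((hdi.const_mul lam).add hki') ?_).trans ?_
  · filter_upwards [ae1, ae2]
    rintro ⟨ξ, _⟩ hξ ⟨i, rfl⟩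
    obtain ⟨j, hj, hkj⟩ := (hkc i).2
    have := hfle ξ hξ j
    dsimp only
    rwa [hkj, ← hj]
  · rw [EReal.coe_le_coe_iff, integral_add (hdi.const_mul lam) hki', integral_const_mul]
    gcongr

theorem expectation_le_of_mem_wassersteinBall {E : Type*} [NormedAddCommGroup E]
    [MeasurableSpace E] [BorelSpace E] [SecondCountableTopology E] {ι : Type*} [Fintype ι]
    [Nonempty ι] {Ξ : Set E} {P : Measure E} {ε : ℝ} (hε : 0 ≤ ε) (a : ι → E) (c : ι → ℝ)
    (hP : P ∈ wassersteinBall Ξ 2 ε ((Fintype.card ι : ℝ≥0∞)⁻¹ • ∑ i, Measure.dirac (a i)))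
    {f : E → EReal} (hf : Measurable f) {lam : ℝ} (hlam : 0 ≤ lam)
    (hfle : ∀ ξ ∈ Ξ, ∀ i, f ξ ≤ ((lam * ‖ξ - a i‖ ^ 2 + c i : ℝ) : EReal)) :
    expectation P f ≤ ((lam * ε ^ 2 + (1 / (Fintype.card ι : ℝ)) * ∑ i, c i : ℝ) : EReal) := by
  obtain ⟨⟨_, hPΞ, _⟩, hW⟩ := hP
  have key : ∀ δ > ε, expectation P f ≤
      ((lam * δ ^ 2 + (1 / (Fintype.card ι : ℝ)) * ∑ i, c i : ℝ) : EReal) := by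
    intro δ hδ
    have hlt := hW.trans_lt ((ENNReal.ofReal_lt_ofReal_iff (hε.trans_lt hδ)).2 hδ)
    unfold wasserstein at hlt
    simp only [iInf_lt_iff] at hlt
    obtain ⟨π, ⟨h1, h2⟩, hπ⟩ := hlt
    exact expectation_le_of_coupling hPΞ a c hf hlam (hε.trans hδ.le) hfle h1 h2 hπ.le
  have hcont : Continuous fun δ : ℝ =>
      ((lam * δ ^ 2 + (1 / (Fintype.card ι : ℝ)) * ∑ i, c i : ℝ) : EReal) :=
    continuous_coe_real_ereal.comp (by fun_prop)
  exact ge_of_tendsto (hcont.continuousWithinAt (s := Set.Ioi ε) (x := ε))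
    (Filter.eventually_of_mem self_mem_nhdsWithin key)

namespace Problem
variable {N₁ N₂ K M J I : ℕ} (p : Problem N₁ N₂ K M J I)

theorem measurable_recourse (x : Fin N₁ → ℝ) : Measurable (p.recourse x) := by
  refine measurable_of_Iio fun r => ?_
  let C : Set (EuclideanSpace ℝ (Fin K) × (Fin N₂ → ℝ)) :=
    {z | p.T x *ᵥ z.1.ofLp + p.h x ≤ p.W *ᵥ z.2}
  let g : EuclideanSpace ℝ (Fin K) × (Fin N₂ → ℝ) → ℝ :=
    fun z => (p.Q *ᵥ z.1.ofLp + p.q) ⬝ᵥ z.2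
  have hC : IsClosed C := isClosed_le (by fun_prop) (by fun_prop)
  have hg : Continuous g := by fun_prop
  have hset : p.recourse x ⁻¹' Set.Iio r =
      ⋃ s : {s : ℚ // ((s : ℝ) : EReal) < r}, Prod.fst '' (C ∩ g ⁻¹' Set.Iic (s : ℝ)) := by
    ext ξ
    simp only [recourse, Set.mem_preimage, Set.mem_Iio, iInf_lt_iff, Set.mem_iUnion, Set.mem_image]
    constructor
    · rintro ⟨y, hy, hlt⟩
      obtain ⟨s, hs1, hs2⟩ := EReal.lt_iff_exists_rat_btwn.1 hlt
      exact ⟨⟨s, hs2⟩, (ξ, y), ⟨hy, (EReal.coe_lt_coe_iff.1 hs1).le⟩, rfl⟩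
    · rintro ⟨⟨s, hs⟩, ⟨_, y⟩, ⟨hy, hle⟩, rfl⟩
      exact ⟨y, hy, (EReal.coe_le_coe_iff.2 hle).trans_lt hs⟩
  rw [hset]
  refine MeasurableSet.iUnion fun s => ?_
  obtain ⟨A, hA, hAeq⟩ : IsSigmaCompact (Prod.fst '' (C ∩ g ⁻¹' Set.Iic (s : ℝ))) :=
    ((isSigmaCompact_univ (X := EuclideanSpace ℝ (Fin K) × (Fin N₂ → ℝ))).of_isClosed_subset
      (hC.inter (isClosed_Iic.preimage hg)) (Set.subset_univ _)).image continuous_fst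
  rw [← hAeq]
  exact MeasurableSet.iUnion fun n => (hA n).measurableSet

theorem dotProduct_cpMatrix_mulVec (x : Fin N₁ → ℝ) (v : CPVars N₂ J I) (i : Fin I)
    (ξ : Fin K → ℝ) (ω : Fin M ⊕ Fin J → ℝ)
    (hω : p.extWᵀ *ᵥ ω = p.extQ *ᵥ ξ + p.extq) :
    Sum.elim (Sum.elim ξ ω) 1 ⬝ᵥ (p.cpMatrix x v i *ᵥ Sum.elim (Sum.elim ξ ω) (1 : Unit → ℝ)) =
      v.lam * (ξ ⬝ᵥ ξ) - 2 * v.lam * (ξ ⬝ᵥ (p.sample i).ofLp) + ∑ j, v.φ i j * p.extq j ^ 2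
        - (p.extT x *ᵥ ξ + p.exth x) ⬝ᵥ ω + p.extq ⬝ᵥ v.ψ i + v.s i := by
  set ψ := v.ψ i
  set φ := v.φ i
  set a := p.extQ *ᵥ ξ with ha
  set b := p.extWᵀ *ᵥ ω with hb
  have e1 : ∀ z : Fin N₂ ⊕ Fin J → ℝ, ξ ⬝ᵥ (p.extQᵀ *ᵥ z) = a ⬝ᵥ z := fun z => by
    rw [dotProduct_mulVec, vecMul_transpose]
  have e2 : ∀ z : Fin N₂ ⊕ Fin J → ℝ, ω ⬝ᵥ (p.extW *ᵥ z) = b ⬝ᵥ z := fun z => by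
    rw [dotProduct_mulVec, hb, mulVec_transpose]
  have e3 : ξ ⬝ᵥ ((p.extT x)ᵀ *ᵥ ω) = (p.extT x *ᵥ ξ) ⬝ᵥ ω := by
    rw [dotProduct_mulVec, vecMul_transpose]
  have e4 : ω ⬝ᵥ (p.extT x *ᵥ ξ) = (p.extT x *ᵥ ξ) ⬝ᵥ ω := dotProduct_comm _ _
  have e5 : ω ⬝ᵥ p.exth x = p.exth x ⬝ᵥ ω := dotProduct_comm _ _
  have hsq : a ⬝ᵥ (diagonal φ *ᵥ a) - a ⬝ᵥ (diagonal φ *ᵥ b) - b ⬝ᵥ (diagonal φ *ᵥ a)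
      + b ⬝ᵥ (diagonal φ *ᵥ b) = ∑ j, φ j * p.extq j ^ 2 := by
    rw [hω]
    simp only [dotProduct, mulVec_diagonal, ← Finset.sum_sub_distrib, ← Finset.sum_add_distrib]
    refine Finset.sum_congr rfl fun j _ => ?_
    simp only [Pi.add_apply]
    ring
  have hψ : b ⬝ᵥ ψ = a ⬝ᵥ ψ + p.extq ⬝ᵥ ψ := by rw [hω, add_dotProduct]
  have hcol : ∀ z : (Fin K ⊕ (Fin M ⊕ Fin J)) → ℝ,
      replicateCol Unit z *ᵥ (1 : Unit → ℝ) = z := fun z => by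
    ext; simp [mulVec, dotProduct]
  have hrow : ∀ z y : (Fin K ⊕ (Fin M ⊕ Fin J)) → ℝ,
      replicateRow Unit z *ᵥ y = fun _ => z ⬝ᵥ y := fun z y => rfl
  have hcor : (of fun _ _ => v.s i : Matrix Unit Unit ℝ) *ᵥ 1 = fun _ => v.s i := by
    ext; simp [mulVec, dotProduct]
  have hone : ∀ z : Unit → ℝ, (1 : Unit → ℝ) ⬝ᵥ z = z () := fun z => by simp [dotProduct]
  unfold cpMatrix
  simp only [fromBlocks_mulVec, Sum.elim_comp_inl, Sum.elim_comp_inr, hcol, hrow, hcor,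
    sumElim_dotProduct_sumElim, hone, dotProduct_add, add_mulVec, sub_mulVec, neg_mulVec,
    smul_mulVec, one_mulVec, dotProduct_sub, dotProduct_neg, dotProduct_smul, smul_eq_mul,
    ← mulVec_mulVec, Pi.add_apply, add_dotProduct, sub_dotProduct, neg_dotProduct,
    smul_dotProduct, e1, e2, e3, e4, e5]
  rw [dotProduct_comm (p.sample i).ofLp ξ, dotProduct_comm (p.extQᵀ *ᵥ v.ψ i) ξ,
    dotProduct_comm (p.extW *ᵥ v.ψ i) ω, e1, e2, ← ha, ← hb]
  linarith

theorem dual_value_le {x : Fin N₁ → ℝ} {v : CPVars N₂ J I} (hv : p.CPFeasible x v) (i : Fin I)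
    {ξ : EuclideanSpace ℝ (Fin K)} (hξ : ξ ∈ p.support) {ρ : Fin M → ℝ} (hρ : 0 ≤ ρ)
    (hρc : p.Q *ᵥ ξ.ofLp + p.q = p.Wᵀ *ᵥ ρ) :
    (p.T x *ᵥ ξ.ofLp + p.h x) ⬝ᵥ ρ ≤ v.lam * ‖ξ - p.sample i‖ ^ 2 +
      (v.s i + p.extq ⬝ᵥ v.ψ i - v.lam * ‖p.sample i‖ ^ 2 + ∑ j, v.φ i j * p.extq j ^ 2) := by
  obtain ⟨hξ0, hξS⟩ := hξ
  set σ : Fin J → ℝ := p.t - p.S *ᵥ ξ.ofLp with hσ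
  have hω : p.extWᵀ *ᵥ Sum.elim ρ σ = p.extQ *ᵥ ξ.ofLp + p.extq := by
    ext (j | j)
    · have := congrFun hρc j
      simpa [extW, extQ, extq, fromBlocks_transpose, fromBlocks_mulVec] using this.symm
    · simp [extW, extQ, extq, fromBlocks_transpose, fromBlocks_mulVec, neg_mulVec, hσ,
        sub_eq_add_neg]
  have hT : (p.extT x *ᵥ ξ.ofLp + p.exth x) ⬝ᵥ Sum.elim ρ σ =
      (p.T x *ᵥ ξ.ofLp + p.h x) ⬝ᵥ ρ := by
    simp [extT, exth, fromRows_mulVec, add_dotProduct, sumElim_dotProduct_sumElim]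
  have hnn : (0 : (Fin K ⊕ (Fin M ⊕ Fin J)) ⊕ Unit → ℝ) ≤
      Sum.elim (Sum.elim ξ.ofLp (Sum.elim ρ σ)) 1 := by
    rintro ((k | k | k) | k)
    exacts [hξ0 k, hρ k, sub_nonneg.2 (hξS k), zero_le_one]
  have key := (hv.2 i).2 _ hnn
  rw [p.dotProduct_cpMatrix_mulVec x v i ξ.ofLp _ hω, hT] at key
  have hinner : inner ℝ ξ (p.sample i) = ξ.ofLp ⬝ᵥ (p.sample i).ofLp := by
    rw [EuclideanSpace.inner_eq_star_dotProduct, star_trivial, dotProduct_comm]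
  have hself : ξ.ofLp ⬝ᵥ ξ.ofLp = ‖ξ‖ ^ 2 := by
    rw [← real_inner_self_eq_norm_sq, EuclideanSpace.inner_eq_star_dotProduct, star_trivial]
  rw [norm_sub_sq_real, hinner]
  rw [hself] at key
  linarith

theorem recourse_le {x : Fin N₁ → ℝ} {v : CPVars N₂ J I} (hv : p.CPFeasible x v)
    (hrec : p.SufficientlyExpensiveRecourse) (i : Fin I)
    {ξ : EuclideanSpace ℝ (Fin K)} (hξ : ξ ∈ p.support) :
    p.recourse x ξ ≤ ((v.lam * ‖ξ - p.sample i‖ ^ 2 +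
      (v.s i + p.extq ⬝ᵥ v.ψ i - v.lam * ‖p.sample i‖ ^ 2 + ∑ j, v.φ i j * p.extq j ^ 2) : ℝ) :
        EReal) := by
  obtain ⟨y, hy, hle⟩ := exists_primal_le_of_dual_le p.W (p.T x *ᵥ ξ.ofLp + p.h x)
    (p.Q *ᵥ ξ.ofLp + p.q) _ (hrec ξ hξ) fun ρ hρ hρc => p.dual_value_le hv i hξ hρ hρc
  exact (iInf₂_le y hy).trans (EReal.coe_le_coe_iff.2 hle)

end Problem
end TwoStage

theorem mainTheorem4 {N₁ N₂ K M J I : ℕ} (p : TwoStage.Problem N₁ N₂ K M J I)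
    (hI : 0 < I) (hsample : ∀ i, p.sample i ∈ p.support) (hε : 0 ≤ p.ε)
    (hrec : p.SufficientlyExpensiveRecourse)
    (x : Fin N₁ → ℝ) (hx : x ∈ p.X) :
    p.worstCase x ≤ p.copositiveValue x := by
  have : Nonempty (Fin I) := ⟨⟨0, hI⟩⟩
  refine le_iInf₂ fun v hv => iSup₂_le fun P hP => ?_
  refine (TwoStage.expectation_le_of_mem_wassersteinBall hε p.sample _
    (by rwa [Fintype.card_fin]) (p.measurable_recourse x) hv.1
    fun ξ hξ i => p.recourse_le hv hrec i hξ).trans (le_of_eq ?_)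
  rw [TwoStage.Problem.cpObjective, Fintype.card_fin, mul_comm v.lam]
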